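/- Let $n\ge 2$, $s\in(0,1)$, and let $\Omega\subseteq\mathbb{R}^n$ be an open set. For $\psi\in C_c^\infty(\mathbb{R}^n)$ let $$\nabla^s\psi(x)=\frac{n-1+s}{\gamma_{1-s}}\int_{\mathbb{R}^n}\frac{(\psi(x)-\psi(y))(x-y)}{|x-y|^{n+s+1}}\,dy,\qquad \gamma_\alpha=2^\alpha\pi^{n/2}\,\frac{\Gamma(\alpha/2)}{\Gamma((n-\alpha)/2)},$$ denote the $s$-fractional gradient. Let $A,\widehat A\in L^\infty(\mathbb{R}^n;\mathbb{R}^{n\times n}_{\rm sym})$ be bounded fields of symmetric matrices with $$A(x)\xi\cdot\xi\ge 0\quad\text{and}\quad \widehat A(x)\xi\cdot\xi\ge 0\quad\text{for a.e. } x\in\Omega\text{ and all }\xi\in\mathbb{R}^n,$$ and assume that $$\int_{\mathbb{R}^n}A(x)\nabla^s\psi(x)\cdot\nabla^s\psi(x)\,dx=\int_{\mathbb{R}^n}\widehat A(x)\nabla^s\psi(x)\cdot\nabla^s\psi(x)\,dx\quad\text{for all }\psi\in C_c^\infty(\Omega).$$ Then $A(x)=\widehat A(x)$ for a.e. $x\in\Omega$.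 -/

import Mathlib

open MeasureTheory
open scoped Matrix ContDiff ENNReal

noncomputable section

/-- The normalising constant `γ_α = 2^α π^(n/2) Γ(α/2) / Γ((n-α)/2)` of the `α`-Riesz potential
on `ℝⁿ`. -/
def rieszConst (n : ℕ) (α : ℝ) : ℝ :=
  2 ^ α * Real.pi ^ ((n : ℝ) / 2) * Real.Gamma (α / 2) / Real.Gamma (((n : ℝ) - α) / 2)

/-- The `s`-fractional gradient
`∇ˢψ(x) = (n-1+s)/γ_(1-s) ∫ (ψ(x)-ψ(y)) (x-y) / |x-y|^(n+s+1) dy`.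
For `s ∈ (0,1)` and `ψ ∈ C_c^∞(ℝⁿ)` the integral converges absolutely at every `x`. -/
def fracGrad {n : ℕ} (s : ℝ) (ψ : EuclideanSpace ℝ (Fin n) → ℝ)
    (x : EuclideanSpace ℝ (Fin n)) : EuclideanSpace ℝ (Fin n) :=
  (((n : ℝ) - 1 + s) / rieszConst n (1 - s)) •
    ∫ y : EuclideanSpace ℝ (Fin n),
      ((ψ x - ψ y) / ‖x - y‖ ^ ((n : ℝ) + s + 1)) • (x - y)

/-- `ψ ∈ C_c^∞(Ω)`: a smooth function on `ℝⁿ` with compact support contained in `Ω`. -/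
def IsTestFunction {n : ℕ} (Ω : Set (EuclideanSpace ℝ (Fin n)))
    (ψ : EuclideanSpace ℝ (Fin n) → ℝ) : Prop :=
  ContDiff ℝ ∞ ψ ∧ HasCompactSupport ψ ∧ tsupport ψ ⊆ Ω

/-- `A ∈ L^∞(ℝⁿ; ℝ^(n×n)_sym)`: every entry is measurable and essentially bounded, and the matrix
`A x` is symmetric for almost every `x`. -/
def IsLinftySym {n : ℕ} (A : EuclideanSpace ℝ (Fin n) → Matrix (Fin n) (Fin n) ℝ) : Prop :=
  (∀ i j, MemLp (fun x => A x i j) ∞ volume) ∧ ∀ᵐ x, (A x).IsSymm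

/-- The quadratic form `Mξ · ξ`. -/
def quadForm {n : ℕ} (M : Matrix (Fin n) (Fin n) ℝ) (ξ : EuclideanSpace ℝ (Fin n)) : ℝ :=
  (M *ᵥ ξ.ofLp) ⬝ᵥ ξ.ofLp

end

/-! The energies see `A` pointwise through high-frequency test functions. For a bump φ supported in
Ω, take ψ(x) = φ(x) cos(k e·x + θ). The fractional gradient of ψ is a constant κ ≠ 0 times −φ(x)
sin(k e·x + θ) k^s V, plus a remainder bounded uniformly in k (`fracGrad_modWave`,
`norm_waveRem_le`). Here V = `waveVec s e` is a nonzero multiple of e, by symmetry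
(`exists_waveVec_eq_smul`) and positivity (`waveVec_ne_zero`).

Divide by k^s and add the energies for θ = 0 and θ = π/2. Since sin² + cos² = 1, the oscillation
cancels exactly, and dominated convergence gives κ² ∫ φ² AV·V
(`tendsto_integral_quadForm_scaledWaveGrad`). Although ψ lives in Ω, its gradient does not, so the
domination over ℝⁿ needs the decay estimate `exists_integral_norm_fracKer_le`.

Equal energies thus give ∫ φ² (A − Â)e·e = 0 for each e. Polarising φ² and applying the fundamental
lemma of the calculus of variations, then choosing suitable e and using symmetry, recovers every
entry. -/

noncomputable section

open Filter Topology Set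
open scoped RealInnerProductSpace

variable {n : ℕ} {s : ℝ}

/-! ### Integrability of the kernels -/

/-- The majorant `min(|h|, 1) / |h|^(n+s)` of the kernels defining the fractional gradient. -/
def fracWeight (n : ℕ) (s : ℝ) (h : EuclideanSpace ℝ (Fin n)) : ℝ :=
  min ‖h‖ 1 / ‖h‖ ^ ((n : ℝ) + s)

/-- The vector kernel `a h / |h|^(n+s+1)` with scalar amplitude `a`. -/
def fracKer {n : ℕ} (s : ℝ) (a : EuclideanSpace ℝ (Fin n) → ℝ)
    (h : EuclideanSpace ℝ (Fin n)) : EuclideanSpace ℝ (Fin n) :=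
  (a h / ‖h‖ ^ ((n : ℝ) + s + 1)) • h

theorem fracWeight_nonneg (h : EuclideanSpace ℝ (Fin n)) : 0 ≤ fracWeight n s h := by
  unfold fracWeight; positivity

/-- In polar coordinates the radial density is t^(-s) on (0,1] and t^(-1-s) on (1,∞): the first is
integrable because s < 1, the second because s > 0. -/
theorem integrable_fracWeight (hn : 2 ≤ n) (hs0 : 0 < s) (hs1 : s < 1) :
    Integrable (fracWeight n s) := by
  have : Nontrivial (EuclideanSpace ℝ (Fin n)) := by
    have : Nontrivial (Fin n) := Fin.nontrivial_iff_two_le.2 hn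
    infer_instance
  have key := (integrable_fun_norm_addHaar (volume : Measure (EuclideanSpace ℝ (Fin n)))
    (f := fun t : ℝ => min t 1 / t ^ ((n : ℝ) + s))).2
  refine key ?_
  rw [finrank_euclideanSpace_fin, ← Ioc_union_Ioi_eq_Ioi (zero_le_one' ℝ)]
  have hpow : ∀ t : ℝ, 0 < t → t ^ ((n : ℝ) + s) = t ^ (n - 1) * t ^ (1 + s) := by
    intro t ht
    rw [← Real.rpow_natCast, ← Real.rpow_add ht, Nat.cast_sub (by omega)]
    congr 1; push_cast; ring
  refine IntegrableOn.union ?_ ?_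
  · have h1 : IntegrableOn (fun t : ℝ => t ^ (-s)) (Ioc 0 1) := by
      rw [← intervalIntegrable_iff_integrableOn_Ioc_of_le zero_le_one]
      exact intervalIntegral.intervalIntegrable_rpow' (by linarith)
    refine h1.congr_fun ?_ measurableSet_Ioc
    intro t ht
    have ht0 : 0 < t := ht.1
    have h2 : 0 < t ^ (1 + s) := Real.rpow_pos_of_pos ht0 _
    simp only [smul_eq_mul]
    rw [hpow t ht0, min_eq_left ht.2, Real.rpow_neg ht0.le, Real.rpow_add ht0, Real.rpow_one]
    field_simp
  · have h1 : IntegrableOn (fun t : ℝ => t ^ (-(1 + s))) (Ioi 1) :=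
      integrableOn_Ioi_rpow_of_lt (by linarith) one_pos
    refine h1.congr_fun ?_ measurableSet_Ioi
    intro t ht
    have ht0 : 0 < t := lt_trans one_pos ht
    have h2 : 0 < t ^ (1 + s) := Real.rpow_pos_of_pos ht0 _
    simp only [smul_eq_mul]
    rw [hpow t ht0, min_eq_right (le_of_lt ht), Real.rpow_neg ht0.le]
    field_simp

theorem norm_fracKer (hs0 : 0 < s) (a : EuclideanSpace ℝ (Fin n) → ℝ)
    (h : EuclideanSpace ℝ (Fin n)) : ‖fracKer s a h‖ = |a h| / ‖h‖ ^ ((n : ℝ) + s) := by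
  unfold fracKer
  have hp : (0 : ℝ) < (n : ℝ) + s := by positivity
  rcases eq_or_ne h 0 with rfl | hh
  · simp [Real.zero_rpow hp.ne']
  · have hh' : 0 < ‖h‖ := norm_pos_iff.2 hh
    have h2 : 0 < ‖h‖ ^ ((n : ℝ) + s) := Real.rpow_pos_of_pos hh' _
    rw [norm_smul, Real.rpow_add_one hh'.ne', norm_div, Real.norm_eq_abs, Real.norm_eq_abs,
      abs_of_pos (mul_pos h2 hh')]
    field_simp

theorem norm_fracKer_le (hs0 : 0 < s) {a : EuclideanSpace ℝ (Fin n) → ℝ} {C : ℝ}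
    (ha : ∀ h, |a h| ≤ C * min ‖h‖ 1) (h : EuclideanSpace ℝ (Fin n)) :
    ‖fracKer s a h‖ ≤ C * fracWeight n s h := by
  rw [norm_fracKer hs0, fracWeight, ← mul_div_assoc]
  gcongr
  exact ha h

theorem measurable_fracKer {a : EuclideanSpace ℝ (Fin n) → ℝ} (ha : Measurable a) :
    Measurable (fracKer s a) := by
  unfold fracKer; fun_prop

theorem integrable_fracKer (hn : 2 ≤ n) (hs0 : 0 < s) (hs1 : s < 1)
    {a : EuclideanSpace ℝ (Fin n) → ℝ} (ham : Measurable a) {C : ℝ}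
    (ha : ∀ h, |a h| ≤ C * min ‖h‖ 1) : Integrable (fracKer s a) :=
  ((integrable_fracWeight hn hs0 hs1).const_mul C).mono' (measurable_fracKer ham).aestronglyMeasurable
    (Eventually.of_forall (norm_fracKer_le hs0 ha))

/-! ### Fractional gradient of a plane wave -/

theorem abs_inner_le_max (e h : EuclideanSpace ℝ (Fin n)) {y : ℝ} (hy1 : |y| ≤ 2)
    (hy : |y| ≤ |⟪e, h⟫|) : |y| ≤ max ‖e‖ 2 * min ‖h‖ 1 := by
  rcases le_total ‖h‖ 1 with h1 | h1
  · rw [min_eq_left h1]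
    exact (hy.trans (abs_real_inner_le_norm e h)).trans (by gcongr; exact le_max_left _ _)
  · rw [min_eq_right h1, mul_one]
    exact hy1.trans (le_max_right _ _)

theorem abs_sin_inner_le (e h : EuclideanSpace ℝ (Fin n)) :
    |Real.sin ⟪e, h⟫| ≤ max ‖e‖ 2 * min ‖h‖ 1 :=
  abs_inner_le_max e h ((Real.abs_sin_le_one _).trans one_le_two) Real.abs_sin_le_abs

theorem abs_one_sub_cos_inner_le (e h : EuclideanSpace ℝ (Fin n)) :
    |1 - Real.cos ⟪e, h⟫| ≤ max ‖e‖ 2 * min ‖h‖ 1 := by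
  set t := ⟪e, h⟫ with ht
  have h0 : 0 ≤ 1 - Real.cos t := by linarith [Real.cos_le_one t]
  have h1 : |1 - Real.cos t| ≤ 2 := by
    rw [abs_of_nonneg h0]; linarith [Real.neg_one_le_cos t]
  refine abs_inner_le_max e h h1 ?_
  rw [← ht, abs_of_nonneg h0]
  -- For |t| ≤ 2, 1 − cos t ≤ t²/2 ≤ |t|; otherwise 1 − cos t ≤ 2 ≤ |t|.
  rcases le_total |t| 2 with h2 | h2
  · nlinarith [Real.one_sub_sq_div_two_le_cos (x := t), sq_abs t, abs_nonneg t]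
  · linarith [Real.neg_one_le_cos t]

/-- The vector `∫ sin(e·h) h / |h|^(n+s+1) dh`, the action of the fractional gradient on the plane
wave of frequency `e`. -/
def waveVec (s : ℝ) (e : EuclideanSpace ℝ (Fin n)) : EuclideanSpace ℝ (Fin n) :=
  ∫ h, fracKer s (fun h => Real.sin ⟪e, h⟫) h

theorem integrable_fracKer_sin (hn : 2 ≤ n) (hs0 : 0 < s) (hs1 : s < 1)
    (e : EuclideanSpace ℝ (Fin n)) : Integrable (fracKer s (fun h => Real.sin ⟪e, h⟫)) :=
  integrable_fracKer hn hs0 hs1 (by fun_prop) (abs_sin_inner_le e)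

theorem integrable_fracKer_one_sub_cos (hn : 2 ≤ n) (hs0 : 0 < s) (hs1 : s < 1)
    (e : EuclideanSpace ℝ (Fin n)) : Integrable (fracKer s (fun h => 1 - Real.cos ⟪e, h⟫)) :=
  integrable_fracKer hn hs0 hs1 (by fun_prop) (abs_one_sub_cos_inner_le e)

/-- The amplitude is even in h, so the vector kernel is odd. -/
theorem integral_fracKer_one_sub_cos (e : EuclideanSpace ℝ (Fin n)) :
    ∫ h, fracKer s (fun h => 1 - Real.cos ⟪e, h⟫) h = 0 := by
  have h1 := integral_neg_eq_self (fracKer s (fun h => 1 - Real.cos ⟪e, h⟫)) volume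
  have h2 : ∀ h, fracKer s (fun h => 1 - Real.cos ⟪e, h⟫) (-h)
      = - fracKer s (fun h => 1 - Real.cos ⟪e, h⟫) h := by
    intro h; simp [fracKer]
  simp only [h2, integral_neg] at h1
  have h3 := add_eq_zero_iff_neg_eq.2 h1
  rw [← two_smul ℝ] at h3
  exact (smul_eq_zero.1 h3).resolve_left two_ne_zero

/-- Substituting h ↦ r h, the kernel scales by r^(-n-s) and the volume by r^n. The resulting growth
r^s lets the leading term dominate at high frequency. -/
theorem waveVec_smul (e : EuclideanSpace ℝ (Fin n)) {r : ℝ} (hr : 0 < r) :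
    waveVec s (r • e) = r ^ s • waveVec s e := by
  have h1 := Measure.integral_comp_smul (volume : Measure (EuclideanSpace ℝ (Fin n)))
    (fracKer s (fun h => Real.sin ⟪e, h⟫)) r
  have h2 : ∀ h, fracKer s (fun h => Real.sin ⟪e, h⟫) (r • h)
      = (r ^ ((n : ℝ) + s))⁻¹ • fracKer s (fun h => Real.sin ⟪r • e, h⟫) h := by
    intro h
    unfold fracKer
    beta_reduce
    rw [norm_smul, Real.norm_of_nonneg hr.le, Real.mul_rpow hr.le (norm_nonneg _), smul_smul,
      smul_smul, Real.rpow_add_one hr.ne', inner_smul_right, real_inner_smul_left]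
    congr 1
    have : 0 < r ^ ((n : ℝ) + s) := Real.rpow_pos_of_pos hr _
    field_simp
  simp only [h2, integral_smul] at h1
  rw [finrank_euclideanSpace_fin, abs_of_pos (by positivity)] at h1
  have hp : 0 < r ^ ((n : ℝ) + s) := Real.rpow_pos_of_pos hr _
  rw [inv_smul_eq_iff₀ hp.ne', smul_smul] at h1
  rw [waveVec, h1, waveVec, Real.rpow_add hr, Real.rpow_natCast]
  congr 1
  field_simp

theorem inner_waveVec (hn : 2 ≤ n) (hs0 : 0 < s) (hs1 : s < 1)
    (e w : EuclideanSpace ℝ (Fin n)) :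
    ⟪w, waveVec s e⟫ = ∫ h, Real.sin ⟪e, h⟫ / ‖h‖ ^ ((n : ℝ) + s + 1) * ⟪w, h⟫ := by
  rw [waveVec, ← integral_inner (integrable_fracKer_sin hn hs0 hs1 e)]
  simp only [fracKer, inner_smul_right]

/-- Reflection in the hyperplane orthogonal to w is an isometry that fixes e and negates w, so it
reverses the sign of the integrand. -/
theorem inner_waveVec_eq_zero (hn : 2 ≤ n) (hs0 : 0 < s) (hs1 : s < 1)
    {e w : EuclideanSpace ℝ (Fin n)} (hw : ⟪w, e⟫ = 0) : ⟪w, waveVec s e⟫ = 0 := by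
  rw [inner_waveVec hn hs0 hs1]
  set f : EuclideanSpace ℝ (Fin n) → ℝ :=
    fun h => Real.sin ⟪e, h⟫ / ‖h‖ ^ ((n : ℝ) + s + 1) * ⟪w, h⟫ with hf
  set T := (ℝ ∙ w)ᗮ.reflection with hT
  have hTe : T e = e :=
    (Submodule.reflection_eq_self_iff e).2 (Submodule.mem_orthogonal_singleton_iff_inner_right.2 hw)
  have hTw : T w = -w := Submodule.reflection_orthogonalComplement_singleton_eq_neg w
  have h1 := T.measurePreserving.integral_comp T.toHomeomorph.measurableEmbedding f
  have h2 : ∀ h, f (T h) = - f h := by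
    intro h
    have a1 : ⟪e, T h⟫ = ⟪e, h⟫ := by
      conv_lhs => rw [← hTe]
      exact T.inner_map_map e h
    have a2 : ⟪w, T h⟫ = -⟪w, h⟫ := by
      have : w = T (-w) := by rw [map_neg, hTw, neg_neg]
      conv_lhs => rw [this]
      rw [T.inner_map_map, inner_neg_left]
    simp only [hf, a1, a2, T.norm_map, mul_neg]
  simp only [h2, integral_neg] at h1
  exact neg_eq_self.1 h1

theorem exists_waveVec_eq_smul (hn : 2 ≤ n) (hs0 : 0 < s) (hs1 : s < 1)
    (e : EuclideanSpace ℝ (Fin n)) : ∃ c : ℝ, waveVec s e = c • e := by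
  have : waveVec s e ∈ (ℝ ∙ e)ᗮᗮ := by
    rw [Submodule.mem_orthogonal]
    intro w hw
    refine inner_waveVec_eq_zero hn hs0 hs1 ?_
    exact Submodule.mem_orthogonal_singleton_iff_inner_left.1 hw
  rw [Submodule.orthogonal_orthogonal] at this
  obtain ⟨c, hc⟩ := Submodule.mem_span_singleton.1 this
  exact ⟨c, hc.symm⟩

/-- The integrand sin(e·h)(e·h) has no sign, but its average over frequencies r e, 0 < r ≤ 1, does:
it is the kernel of 1 − cos(e·h). If V vanished, homogeneity would make all these integrals vanish,
forcing a nonnegative function that is not identically zero to have integral zero. -/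
theorem waveVec_ne_zero (hn : 2 ≤ n) (hs0 : 0 < s) (hs1 : s < 1)
    {e : EuclideanSpace ℝ (Fin n)} (he : e ≠ 0) : waveVec s e ≠ 0 := by
  intro h0
  set F : EuclideanSpace ℝ (Fin n) → ℝ → ℝ :=
    fun h r => Real.sin (r * ⟪e, h⟫) / ‖h‖ ^ ((n : ℝ) + s + 1) * ⟪e, h⟫ with hF
  set ν : Measure ℝ := volume.restrict (Ioc 0 1) with hν
  have hFm : Measurable (Function.uncurry F) := by
    simp only [hF, Function.uncurry_def]; fun_prop
  have hint : Integrable (Function.uncurry F) (volume.prod ν) := by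
    have hb : Integrable (fun z : EuclideanSpace ℝ (Fin n) × ℝ =>
        (max ‖e‖ 2 * fracWeight n s z.1 * ‖e‖) * 1) (volume.prod ν) :=
      (((integrable_fracWeight hn hs0 hs1).const_mul _).mul_const _).mul_prod
        (integrable_const (1 : ℝ))
    refine hb.mono' hFm.aestronglyMeasurable ?_
    have hae : ∀ᵐ z : EuclideanSpace ℝ (Fin n) × ℝ ∂(volume.prod ν), z.2 ∈ Ioc (0 : ℝ) 1 :=
      (Measure.quasiMeasurePreserving_snd (μ := (volume : Measure (EuclideanSpace ℝ (Fin n))))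
        (ν := ν)).ae (ae_restrict_mem measurableSet_Ioc)
    filter_upwards [hae] with z hz
    obtain ⟨h, r⟩ := z
    simp only at hz
    have e1 : F h r = ⟪e, fracKer s (fun h => Real.sin ⟪r • e, h⟫) h⟫ := by
      simp only [hF, fracKer, inner_smul_right, real_inner_smul_left]
    have hle : ∀ h, |Real.sin ⟪r • e, h⟫| ≤ max ‖e‖ 2 * min ‖h‖ 1 := by
      intro h
      refine (abs_sin_inner_le _ h).trans ?_
      gcongr
      rw [norm_smul, Real.norm_of_nonneg hz.1.le]
      nlinarith [norm_nonneg e, hz.2]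
    simp only [Function.uncurry, mul_one]
    rw [e1, mul_comm _ ‖e‖]
    refine (norm_inner_le_norm _ _).trans ?_
    gcongr
    exact norm_fracKer_le hs0 hle h
  have hswap := integral_integral_swap hint
  have hR : ∫ r, (∫ h, F h r) ∂ν = 0 := by
    refine integral_eq_zero_of_ae ?_
    filter_upwards [ae_restrict_mem measurableSet_Ioc] with r hr
    have := inner_waveVec hn hs0 hs1 (r • e) e
    rw [waveVec_smul e hr.1, h0, smul_zero, inner_zero_right] at this
    simp only [real_inner_smul_left] at this
    exact this.symm
  have hL : ∀ h, ∫ r, F h r ∂ν = (1 - Real.cos ⟪e, h⟫) / ‖h‖ ^ ((n : ℝ) + s + 1) := by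
    intro h
    rw [hν, ← intervalIntegral.integral_of_le zero_le_one]
    have : ∀ r, HasDerivAt (fun r : ℝ => -Real.cos (r * ⟪e, h⟫) / ‖h‖ ^ ((n : ℝ) + s + 1))
        (F h r) r := by
      intro r
      have := ((((hasDerivAt_id r).mul_const ⟪e, h⟫).cos).neg).div_const (‖h‖ ^ ((n : ℝ) + s + 1))
      refine this.congr_deriv ?_
      simp only [hF, id, one_mul, neg_neg, neg_mul]; ring
    rw [intervalIntegral.integral_eq_sub_of_hasDerivAt (fun r _ => this r)
      (Continuous.intervalIntegrable (by simp only [hF]; fun_prop) _ _)]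
    simp; ring
  rw [hR, integral_congr_ae (Eventually.of_forall hL)] at hswap
  have hint2 : Integrable
      (fun h : EuclideanSpace ℝ (Fin n) => (1 - Real.cos ⟪e, h⟫) / ‖h‖ ^ ((n : ℝ) + s + 1)) := by
    have := hint.integral_prod_left
    simpa only [Function.uncurry, hL] using this
  rw [integral_eq_zero_iff_of_nonneg (fun h => div_nonneg (by simpa using Real.cos_le_one _)
    (by positivity)) hint2] at hswap
  have hcont : ContinuousOn
      (fun h : EuclideanSpace ℝ (Fin n) => (1 - Real.cos ⟪e, h⟫) / ‖h‖ ^ ((n : ℝ) + s + 1))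
      {0}ᶜ := by
    refine ContinuousOn.div (by fun_prop) ?_ ?_
    · exact (continuous_norm.rpow_const (fun _ => Or.inr (by positivity))).continuousOn
    · intro h hh
      exact (Real.rpow_pos_of_pos (norm_pos_iff.2 hh) _).ne'
  have hz := Measure.eqOn_open_of_ae_eq (ae_restrict_of_ae hswap) isOpen_compl_singleton hcont
    continuousOn_const
  have he2 : ‖e‖ ≠ 0 := norm_ne_zero_iff.2 he
  -- At this point the phase e·h equals π, so 1 − cos(e·h) = 2.
  have hx : ((Real.pi / ‖e‖ ^ 2) • e) ∈ ({0}ᶜ : Set (EuclideanSpace ℝ (Fin n))) := by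
    simp [he, Real.pi_ne_zero]
  have := hz hx
  simp only [inner_smul_right, real_inner_self_eq_norm_sq] at this
  rw [div_mul_cancel₀ _ (by positivity), Real.cos_pi] at this
  have h3 : 0 < ‖(Real.pi / ‖e‖ ^ 2) • e‖ ^ ((n : ℝ) + s + 1) :=
    Real.rpow_pos_of_pos (norm_pos_iff.2 hx) _
  simp only [Pi.zero_apply, div_eq_zero_iff, h3.ne', or_false] at this
  norm_num at this

/-! ### Bounds and decay for a smooth amplitude -/

theorem fracGrad_eq (ψ : EuclideanSpace ℝ (Fin n) → ℝ) (x : EuclideanSpace ℝ (Fin n)) :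
    fracGrad s ψ x = (((n : ℝ) - 1 + s) / rieszConst n (1 - s)) •
      ∫ h, fracKer s (fun h => ψ x - ψ (x - h)) h := by
  rw [fracGrad, ← integral_sub_left_eq_self
    (fun y => ((ψ x - ψ y) / ‖x - y‖ ^ ((n : ℝ) + s + 1)) • (x - y)) volume x]
  simp only [sub_sub_cancel, fracKer]

theorem fracGrad_const_ne_zero (hn : 2 ≤ n) (hs0 : 0 < s) (hs1 : s < 1) :
    ((n : ℝ) - 1 + s) / rieszConst n (1 - s) ≠ 0 := by
  have hn' : (2 : ℝ) ≤ n := by exact_mod_cast hn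
  have h1 : 0 < Real.Gamma ((1 - s) / 2) := Real.Gamma_pos_of_pos (by linarith)
  have h2 : 0 < Real.Gamma (((n : ℝ) - (1 - s)) / 2) := Real.Gamma_pos_of_pos (by linarith)
  have h3 : 0 < rieszConst n (1 - s) := by unfold rieszConst; positivity
  have h4 : 0 < (n : ℝ) - 1 + s := by linarith
  positivity

theorem stronglyMeasurable_fracGrad {ψ : EuclideanSpace ℝ (Fin n) → ℝ} (hψ : Continuous ψ) :
    StronglyMeasurable (fracGrad s ψ) := by
  have : StronglyMeasurable (fun x : EuclideanSpace ℝ (Fin n) =>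
      ∫ y, ((ψ x - ψ y) / ‖x - y‖ ^ ((n : ℝ) + s + 1)) • (x - y)) := by
    refine StronglyMeasurable.integral_prod_right ?_
    refine Measurable.stronglyMeasurable ?_
    have := hψ.measurable
    simp only [Function.uncurry_def]
    fun_prop
  exact this.const_smul (((n : ℝ) - 1 + s) / rieszConst n (1 - s))

theorem exists_abs_sub_le {φ : EuclideanSpace ℝ (Fin n) → ℝ} (hφ : ContDiff ℝ ∞ φ)
    (hc : HasCompactSupport φ) :
    ∃ C, 0 ≤ C ∧ ∀ x h, |φ x - φ (x - h)| ≤ C * min ‖h‖ 1 := by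
  obtain ⟨L, hL⟩ := ContDiff.lipschitzWith_of_hasCompactSupport hc hφ (by simp)
  obtain ⟨M, hM⟩ := hc.exists_bound_of_continuous hφ.continuous
  refine ⟨max L (2 * M), le_max_of_le_left L.2, fun x h => ?_⟩
  rcases le_total ‖h‖ 1 with h1 | h1
  · rw [min_eq_left h1]
    have := hL.dist_le_mul x (x - h)
    rw [Real.dist_eq, dist_eq_norm, sub_sub_cancel] at this
    exact this.trans (by gcongr; exact le_max_left _ _)
  · rw [min_eq_right h1, mul_one]
    refine le_trans ?_ (le_max_right _ _)
    have a := hM x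
    have b := hM (x - h)
    rw [Real.norm_eq_abs] at a b
    have := abs_sub (φ x) (φ (x - h))
    linarith

/-- For bounded x the kernel majorant suffices. Far from the support only φ(x − h) survives, which
forces |h| to be comparable to |x|. The exponent n + s > n makes the bound integrable over ℝⁿ. -/
theorem exists_integral_norm_fracKer_le (hn : 2 ≤ n) (hs0 : 0 < s) (hs1 : s < 1)
    {φ : EuclideanSpace ℝ (Fin n) → ℝ} (hφ : ContDiff ℝ ∞ φ) (hc : HasCompactSupport φ) :
    ∃ K, 0 ≤ K ∧ ∀ x, ∫ h, ‖fracKer s (fun h => φ x - φ (x - h)) h‖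
      ≤ K * (1 + ‖x‖) ^ (-((n : ℝ) + s)) := by
  obtain ⟨C, hC0, hC⟩ := exists_abs_sub_le hφ hc
  obtain ⟨R, hR1, hR⟩ : ∃ R : ℝ, 1 ≤ R ∧ ∀ x, R ≤ ‖x‖ → φ x = 0 := by
    obtain ⟨R, hR⟩ := hc.isCompact.isBounded.subset_ball 0
    refine ⟨max R 1, le_max_right _ _, fun x hx => ?_⟩
    by_contra hne
    have := hR (subset_tsupport φ hne)
    rw [mem_ball_zero_iff] at this
    linarith [le_max_left R 1]
  have hp : 0 < (n : ℝ) + s := by positivity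
  set p := (n : ℝ) + s with hpdef
  have hW := integrable_fracWeight hn hs0 hs1
  have hφi : Integrable φ := hφ.continuous.integrable_of_hasCompactSupport hc
  set W := ∫ h : EuclideanSpace ℝ (Fin n), fracWeight n s h with hWdef
  set I := ∫ h, |φ h| with hI
  have hW0 : 0 ≤ W := integral_nonneg fracWeight_nonneg
  have hI0 : 0 ≤ I := integral_nonneg fun _ => abs_nonneg _
  refine ⟨C * W * (1 + 2 * R) ^ p + 4 ^ p * I, by positivity, fun x => ?_⟩
  have hx1 : 0 < 1 + ‖x‖ := by positivity
  have hpos : 0 < (1 + ‖x‖) ^ (-p) := Real.rpow_pos_of_pos hx1 _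
  have hm : Measurable (fun h => φ x - φ (x - h)) := by
    have := hφ.continuous
    exact Continuous.measurable (by fun_prop)
  have hint := (integrable_fracKer hn hs0 hs1 hm (hC x)).norm
  rcases le_total ‖x‖ (2 * R) with hx | hx
  · have h1 : ∫ h, ‖fracKer s (fun h => φ x - φ (x - h)) h‖ ≤ C * W := by
      rw [hWdef, ← integral_const_mul]
      exact integral_mono hint (hW.const_mul _) (norm_fracKer_le hs0 (hC x))
    have h2 : 1 ≤ (1 + 2 * R) ^ p * (1 + ‖x‖) ^ (-p) := by
      rw [Real.rpow_neg hx1.le, ← div_eq_mul_inv, one_le_div (by positivity)]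
      gcongr
    calc _ ≤ C * W * 1 := by rw [mul_one]; exact h1
      _ ≤ C * W * ((1 + 2 * R) ^ p * (1 + ‖x‖) ^ (-p)) := by gcongr
      _ ≤ _ := by
        have : 0 ≤ 4 ^ p * I * (1 + ‖x‖) ^ (-p) := by positivity
        linarith
  · have h1 : ∫ h, ‖fracKer s (fun h => φ x - φ (x - h)) h‖
        ≤ ∫ h, (4 ^ p * (1 + ‖x‖) ^ (-p)) * |φ (x - h)| := by
      refine integral_mono hint ((hφi.abs.comp_sub_left x).const_mul _) fun h => ?_
      simp only
      rw [norm_fracKer hs0, hR x (by linarith), zero_sub, abs_neg]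
      by_cases hz : φ (x - h) = 0
      · simp [hz]
      · have h3 : ‖x - h‖ < R := by
          by_contra hcon
          exact hz (hR _ (not_lt.1 hcon))
        -- ‖h‖ > ‖x‖ − R ≥ ‖x‖/2, and ‖x‖ ≥ 2R ≥ 2 absorbs the 1.
        have h4 : (1 + ‖x‖) / 4 ≤ ‖h‖ := by
          have := norm_sub_norm_le x h
          linarith
        have h5 : 4 ^ p * (1 + ‖x‖) ^ (-p) = (((1 + ‖x‖) / 4) ^ p)⁻¹ := by
          rw [Real.div_rpow hx1.le (by norm_num), Real.rpow_neg hx1.le, inv_div, div_eq_mul_inv]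
        rw [h5, div_eq_inv_mul]
        gcongr
    rw [integral_const_mul, integral_sub_left_eq_self (fun y => |φ y|) volume x] at h1
    refine h1.trans ?_
    have : 0 ≤ C * W * (1 + 2 * R) ^ p * (1 + ‖x‖) ^ (-p) := by positivity
    linarith

/-! ### Modulated plane waves -/

/-- The plane wave `cos(e·x + θ)` with amplitude `φ`. -/
def modWave (φ : EuclideanSpace ℝ (Fin n) → ℝ) (e : EuclideanSpace ℝ (Fin n)) (θ : ℝ)
    (x : EuclideanSpace ℝ (Fin n)) : ℝ :=
  φ x * Real.cos (⟪e, x⟫ + θ)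

theorem isTestFunction_modWave {Ω : Set (EuclideanSpace ℝ (Fin n))}
    {φ : EuclideanSpace ℝ (Fin n) → ℝ} (hφ : IsTestFunction Ω φ) (e : EuclideanSpace ℝ (Fin n))
    (θ : ℝ) : IsTestFunction Ω (modWave φ e θ) := by
  obtain ⟨h1, h2, h3⟩ := hφ
  refine ⟨?_, h2.mul_right, (tsupport_mul_subset_left).trans h3⟩
  unfold modWave
  refine h1.mul (Real.contDiff_cos.comp ?_)
  exact (contDiff_const.inner ℝ contDiff_id).add contDiff_const

/-- The remainder in the fractional gradient of an amplitude-modulated plane wave. -/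
def waveRem (s : ℝ) (φ : EuclideanSpace ℝ (Fin n) → ℝ) (e : EuclideanSpace ℝ (Fin n)) (θ : ℝ)
    (x : EuclideanSpace ℝ (Fin n)) : EuclideanSpace ℝ (Fin n) :=
  ∫ h, fracKer s (fun h => (φ x - φ (x - h)) * Real.cos (⟪e, x - h⟫ + θ)) h

/-- The cosine is at most 1 in modulus, so the bound does not depend on the frequency or the phase.
-/
theorem norm_waveRem_le (hn : 2 ≤ n) (hs0 : 0 < s) (hs1 : s < 1)
    {φ : EuclideanSpace ℝ (Fin n) → ℝ} (hφ : ContDiff ℝ ∞ φ) (hc : HasCompactSupport φ)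
    (e : EuclideanSpace ℝ (Fin n)) (θ : ℝ) (x : EuclideanSpace ℝ (Fin n)) :
    ‖waveRem s φ e θ x‖ ≤ ∫ h, ‖fracKer s (fun h => φ x - φ (x - h)) h‖ := by
  obtain ⟨C, hC0, hC⟩ := exists_abs_sub_le hφ hc
  have hcont := hφ.continuous
  have hm : Measurable (fun h => φ x - φ (x - h)) := Continuous.measurable (by fun_prop)
  refine norm_integral_le_of_norm_le (integrable_fracKer hn hs0 hs1 hm (hC x)).norm
    (Eventually.of_forall fun h => ?_)
  rw [norm_fracKer hs0, norm_fracKer hs0, abs_mul]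
  gcongr
  exact mul_le_of_le_one_right (abs_nonneg _) (Real.abs_cos_le_one _)

/-- The increment splits into φ(x) times the increment of the cosine and the increment of φ times
the shifted cosine. The addition formula turns the former into a sine part, which gives `waveVec`,
and a 1 − cos part, which integrates to zero by oddness. -/
theorem fracGrad_modWave (hn : 2 ≤ n) (hs0 : 0 < s) (hs1 : s < 1)
    {φ : EuclideanSpace ℝ (Fin n) → ℝ} (hφ : ContDiff ℝ ∞ φ) (hc : HasCompactSupport φ)
    (e : EuclideanSpace ℝ (Fin n)) (θ : ℝ) (x : EuclideanSpace ℝ (Fin n)) :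
    fracGrad s (modWave φ e θ) x = (((n : ℝ) - 1 + s) / rieszConst n (1 - s)) •
      (-(φ x * Real.sin (⟪e, x⟫ + θ)) • waveVec s e + waveRem s φ e θ x) := by
  obtain ⟨C, hC0, hC⟩ := exists_abs_sub_le hφ hc
  have hcont := hφ.continuous
  rw [fracGrad_eq]
  congr 1
  have hm : Measurable (fun h => (φ x - φ (x - h)) * Real.cos (⟪e, x - h⟫ + θ)) :=
    Continuous.measurable (by fun_prop)
  have i1 := integrable_fracKer_sin hn hs0 hs1 e
  have i2 := integrable_fracKer_one_sub_cos hn hs0 hs1 e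
  have i3 := integrable_fracKer hn hs0 hs1 hm (C := C) fun h => by
    rw [abs_mul]
    exact (mul_le_of_le_one_right (abs_nonneg _) (Real.abs_cos_le_one _)).trans (hC x h)
  have hsplit : ∀ h, fracKer s (fun h => modWave φ e θ x - modWave φ e θ (x - h)) h
      = (-(φ x * Real.sin (⟪e, x⟫ + θ)) • fracKer s (fun h => Real.sin ⟪e, h⟫) h
        + (φ x * Real.cos (⟪e, x⟫ + θ)) • fracKer s (fun h => 1 - Real.cos ⟪e, h⟫) h)
        + fracKer s (fun h => (φ x - φ (x - h)) * Real.cos (⟪e, x - h⟫ + θ)) h := by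
    intro h
    simp only [fracKer, smul_smul, ← add_smul]
    congr 1
    have hcos : Real.cos (⟪e, x - h⟫ + θ) = Real.cos (⟪e, x⟫ + θ) * Real.cos ⟪e, h⟫
        + Real.sin (⟪e, x⟫ + θ) * Real.sin ⟪e, h⟫ := by
      rw [← Real.cos_sub, inner_sub_right]; congr 1; ring
    simp only [modWave, hcos]
    ring
  have j1 : Integrable fun h => -(φ x * Real.sin (⟪e, x⟫ + θ)) •
      fracKer s (fun h => Real.sin ⟪e, h⟫) h :=
    i1.smul (-(φ x * Real.sin (⟪e, x⟫ + θ)))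
  have j2 : Integrable fun h => (φ x * Real.cos (⟪e, x⟫ + θ)) •
      fracKer s (fun h => 1 - Real.cos ⟪e, h⟫) h :=
    i2.smul (φ x * Real.cos (⟪e, x⟫ + θ))
  rw [integral_congr_ae (Eventually.of_forall hsplit)]
  refine (integral_add (j1.add j2) i3).trans ?_
  rw [integral_add' j1 j2, integral_smul, integral_smul, integral_fracKer_one_sub_cos, smul_zero,
    add_zero]
  rfl

/-! ### Estimates for the quadratic form -/

theorem quadForm_eq_sum (M : Matrix (Fin n) (Fin n) ℝ) (ξ : EuclideanSpace ℝ (Fin n)) :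
    quadForm M ξ = ∑ i, ∑ j, M i j * ξ j * ξ i := by
  simp only [quadForm, Matrix.mulVec, dotProduct, Finset.sum_mul]

theorem quadForm_smul (M : Matrix (Fin n) (Fin n) ℝ) (c : ℝ) (ξ : EuclideanSpace ℝ (Fin n)) :
    quadForm M (c • ξ) = c ^ 2 * quadForm M ξ := by
  simp only [quadForm_eq_sum, Finset.mul_sum, PiLp.smul_apply, smul_eq_mul]
  refine Finset.sum_congr rfl fun i _ => Finset.sum_congr rfl fun j _ => by ring

theorem abs_quadForm_le {M : Matrix (Fin n) (Fin n) ℝ} {B : ℝ} (hM : ∀ i j, |M i j| ≤ B)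
    (ξ : EuclideanSpace ℝ (Fin n)) : |quadForm M ξ| ≤ n ^ 2 * B * ‖ξ‖ ^ 2 := by
  rw [quadForm_eq_sum]
  have : ∀ i j, |M i j * ξ j * ξ i| ≤ B * ‖ξ‖ * ‖ξ‖ := by
    intro i j
    have hB : 0 ≤ B := (abs_nonneg _).trans (hM i j)
    rw [abs_mul, abs_mul]
    gcongr
    · exact hM i j
    · exact PiLp.norm_apply_le ξ j
    · exact PiLp.norm_apply_le ξ i
  calc _ ≤ ∑ i, ∑ j, |M i j * ξ j * ξ i| :=
        (Finset.abs_sum_le_sum_abs _ _).trans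
          (Finset.sum_le_sum fun i _ => Finset.abs_sum_le_sum_abs _ _)
    _ ≤ ∑ _i : Fin n, ∑ _j : Fin n, B * ‖ξ‖ * ‖ξ‖ :=
        Finset.sum_le_sum fun i _ => Finset.sum_le_sum fun j _ => this i j
    _ = _ := by simp; ring

theorem abs_quadForm_add_sub_le {M : Matrix (Fin n) (Fin n) ℝ} {B : ℝ}
    (hM : ∀ i j, |M i j| ≤ B) (u v : EuclideanSpace ℝ (Fin n)) :
    |quadForm M (u + v) - quadForm M u| ≤ n ^ 2 * B * (2 * ‖u‖ * ‖v‖ + ‖v‖ ^ 2) := by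
  have h0 : quadForm M (u + v) - quadForm M u
      = ∑ i, ∑ j, M i j * (u j * v i + v j * u i + v j * v i) := by
    simp only [quadForm_eq_sum, ← Finset.sum_sub_distrib, PiLp.add_apply]
    refine Finset.sum_congr rfl fun i _ => Finset.sum_congr rfl fun j _ => by ring
  rw [h0]
  have : ∀ i j, |M i j * (u j * v i + v j * u i + v j * v i)|
      ≤ B * (2 * ‖u‖ * ‖v‖ + ‖v‖ ^ 2) := by
    intro i j
    have hB : 0 ≤ B := (abs_nonneg _).trans (hM i j)
    rw [abs_mul]
    gcongr
    · exact hM i j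
    have hm : ∀ (a b : EuclideanSpace ℝ (Fin n)) (k l : Fin n), |a k * b l| ≤ ‖a‖ * ‖b‖ := by
      intro a b k l
      rw [abs_mul]
      exact mul_le_mul (PiLp.norm_apply_le a k) (PiLp.norm_apply_le b l) (abs_nonneg _)
        (norm_nonneg _)
    have := abs_add_three (u j * v i) (v j * u i) (v j * v i)
    nlinarith [hm u v j i, hm v u j i, hm v v j i]
  calc _ ≤ ∑ i, ∑ j, |M i j * (u j * v i + v j * u i + v j * v i)| :=
        (Finset.abs_sum_le_sum_abs _ _).trans
          (Finset.sum_le_sum fun i _ => Finset.abs_sum_le_sum_abs _ _)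
    _ ≤ ∑ _i : Fin n, ∑ _j : Fin n, B * (2 * ‖u‖ * ‖v‖ + ‖v‖ ^ 2) :=
        Finset.sum_le_sum fun i _ => Finset.sum_le_sum fun j _ => this i j
    _ = _ := by simp; ring

theorem aestronglyMeasurable_quadForm
    {A : EuclideanSpace ℝ (Fin n) → Matrix (Fin n) (Fin n) ℝ}
    (hA : ∀ i j, MemLp (fun x => A x i j) ∞ volume)
    {F : EuclideanSpace ℝ (Fin n) → EuclideanSpace ℝ (Fin n)} (hF : StronglyMeasurable F) :
    AEStronglyMeasurable (fun x => quadForm (A x) (F x)) := by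
  simp only [quadForm_eq_sum]
  have hF' : ∀ i, AEStronglyMeasurable (fun x => F x i) := fun i =>
    ((EuclideanSpace.proj (𝕜 := ℝ) i).continuous.comp_stronglyMeasurable hF).aestronglyMeasurable
  exact Finset.aestronglyMeasurable_fun_sum _ fun i _ =>
    Finset.aestronglyMeasurable_fun_sum _ fun j _ => ((hA i j).1.mul (hF' j)).mul (hF' i)

theorem exists_ae_abs_le {A : EuclideanSpace ℝ (Fin n) → Matrix (Fin n) (Fin n) ℝ}
    (hA : ∀ i j, MemLp (fun x => A x i j) ∞ volume) :
    ∃ B, 0 ≤ B ∧ ∀ᵐ x, ∀ i j, |A x i j| ≤ B := by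
  have : ∀ i j, ∃ B, ∀ᵐ x, |A x i j| ≤ B := fun i j =>
    ⟨_, ae_le_lpNorm_exponent_top (hA i j)⟩
  choose b hb using this
  refine ⟨∑ i, ∑ j, |b i j|, by positivity, ?_⟩
  have hall : ∀ᵐ x, ∀ i j, |A x i j| ≤ b i j := ae_all_iff.2 fun i => ae_all_iff.2 fun j => hb i j
  filter_upwards [hall] with x hx i j
  refine (hx i j).trans ((le_abs_self _).trans ?_)
  refine le_trans ?_ (Finset.single_le_sum (f := fun i => ∑ j, |b i j|)
    (fun i _ => by positivity) (Finset.mem_univ i))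
  exact Finset.single_le_sum (f := fun j => |b i j|) (fun j _ => abs_nonneg _) (Finset.mem_univ j)

/-! ### High-frequency limit of the energies -/

/-- The fractional gradient of the modulated plane wave of frequency `(k+1) e`, divided by
`(k+1)^s`. -/
def scaledWaveGrad (s : ℝ) (φ : EuclideanSpace ℝ (Fin n) → ℝ) (e : EuclideanSpace ℝ (Fin n))
    (θ : ℝ) (k : ℕ) (x : EuclideanSpace ℝ (Fin n)) : EuclideanSpace ℝ (Fin n) :=
  (((k : ℝ) + 1) ^ s)⁻¹ • fracGrad s (modWave φ (((k : ℝ) + 1) • e) θ) x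

theorem scaledWaveGrad_eq (hn : 2 ≤ n) (hs0 : 0 < s) (hs1 : s < 1)
    {φ : EuclideanSpace ℝ (Fin n) → ℝ} (hφ : ContDiff ℝ ∞ φ) (hc : HasCompactSupport φ)
    (e : EuclideanSpace ℝ (Fin n)) (θ : ℝ) (k : ℕ) (x : EuclideanSpace ℝ (Fin n)) :
    scaledWaveGrad s φ e θ k x = (((n : ℝ) - 1 + s) / rieszConst n (1 - s)) •
      (-(φ x * Real.sin (⟪((k : ℝ) + 1) • e, x⟫ + θ)) • waveVec s e
        + (((k : ℝ) + 1) ^ s)⁻¹ • waveRem s φ (((k : ℝ) + 1) • e) θ x) := by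
  have hk : 0 < (k : ℝ) + 1 := by positivity
  have hks : ((k : ℝ) + 1) ^ s ≠ 0 := (Real.rpow_pos_of_pos hk s).ne'
  rw [scaledWaveGrad, fracGrad_modWave hn hs0 hs1 hφ hc, waveVec_smul e hk, smul_comm]
  congr 1
  rw [smul_add, smul_comm (((k : ℝ) + 1) ^ s)⁻¹, inv_smul_smul₀ hks]

theorem stronglyMeasurable_scaledWaveGrad {φ : EuclideanSpace ℝ (Fin n) → ℝ} (hφ : Continuous φ)
    (e : EuclideanSpace ℝ (Fin n)) (θ : ℝ) (k : ℕ) :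
    StronglyMeasurable (scaledWaveGrad s φ e θ k) := by
  have : Continuous (modWave φ (((k : ℝ) + 1) • e) θ) := by unfold modWave; fun_prop
  exact (stronglyMeasurable_fracGrad this).const_smul ((((k : ℝ) + 1) ^ s)⁻¹)

theorem integrable_sq_of_hasCompactSupport {φ : EuclideanSpace ℝ (Fin n) → ℝ} (hφ : Continuous φ)
    (hc : HasCompactSupport φ) : Integrable fun x => φ x ^ 2 := by
  have h : HasCompactSupport fun x => φ x * φ x := hc.mul_right
  simp only [pow_two]
  exact (hφ.mul hφ).integrable_of_hasCompactSupport h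

theorem tendsto_integral_quadForm_scaledWaveGrad (hn : 2 ≤ n) (hs0 : 0 < s) (hs1 : s < 1)
    {φ : EuclideanSpace ℝ (Fin n) → ℝ} (hφ : ContDiff ℝ ∞ φ) (hc : HasCompactSupport φ)
    (e : EuclideanSpace ℝ (Fin n)) {A : EuclideanSpace ℝ (Fin n) → Matrix (Fin n) (Fin n) ℝ}
    (hA : ∀ i j, MemLp (fun x => A x i j) ∞ volume) :
    Tendsto (fun k => (∫ x, quadForm (A x) (scaledWaveGrad s φ e 0 k x))
      + ∫ x, quadForm (A x) (scaledWaveGrad s φ e (Real.pi / 2) k x)) atTop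
      (𝓝 (∫ x, (((n : ℝ) - 1 + s) / rieszConst n (1 - s)) ^ 2 *
        (φ x ^ 2 * quadForm (A x) (waveVec s e)))) := by
  obtain ⟨B, hB0, hB⟩ := exists_ae_abs_le hA
  obtain ⟨K, hK0, hK⟩ := exists_integral_norm_fracKer_le hn hs0 hs1 hφ hc
  set κ := ((n : ℝ) - 1 + s) / rieszConst n (1 - s) with hκ
  set V := waveVec s e with hV
  -- Frequency k + 1 rather than k ensures ε k ≤ 1 already at k = 0.
  set ε : ℕ → ℝ := fun k => (((k : ℝ) + 1) ^ s)⁻¹ with hε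
  set g : EuclideanSpace ℝ (Fin n) → ℝ := fun x => (1 + ‖x‖) ^ (-((n : ℝ) + s)) with hg
  set u : ℝ → ℕ → EuclideanSpace ℝ (Fin n) → EuclideanSpace ℝ (Fin n) :=
    fun θ k x => -(φ x * Real.sin (⟪((k : ℝ) + 1) • e, x⟫ + θ)) • V with hu
  set v : ℝ → ℕ → EuclideanSpace ℝ (Fin n) → EuclideanSpace ℝ (Fin n) :=
    fun θ k x => ε k • waveRem s φ (((k : ℝ) + 1) • e) θ x with hv
  have hF : ∀ θ k x, scaledWaveGrad s φ e θ k x = κ • (u θ k x + v θ k x) := fun θ k x =>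
    scaledWaveGrad_eq hn hs0 hs1 hφ hc e θ k x
  have hε0 : ∀ k, 0 ≤ ε k := fun k => by positivity
  have hε1 : ∀ k, ε k ≤ 1 := fun k =>
    inv_le_one_of_one_le₀ (Real.one_le_rpow (by simp) hs0.le)
  have hεlim : Tendsto ε atTop (𝓝 0) :=
    ((tendsto_rpow_atTop hs0).comp
      (tendsto_atTop_add_const_right _ 1 tendsto_natCast_atTop_atTop)).inv_tendsto_atTop
  have hg0 : ∀ x, 0 ≤ g x := fun x => by positivity
  have hg1 : ∀ x, g x ≤ 1 := fun x =>
    Real.rpow_le_one_of_one_le_of_nonpos (by simp) (by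
      have : (0 : ℝ) ≤ n := by positivity
      linarith)
  have hgi : Integrable g := integrable_one_add_norm (by
    rw [finrank_euclideanSpace_fin]; linarith)
  have hun : ∀ θ k x, ‖u θ k x‖ ≤ |φ x| * ‖V‖ := by
    intro θ k x
    rw [hu]
    simp only [norm_smul, norm_neg, norm_mul, Real.norm_eq_abs]
    gcongr
    exact mul_le_of_le_one_right (abs_nonneg _) (Real.abs_sin_le_one _)
  have hvn : ∀ θ k x, ‖v θ k x‖ ≤ ε k * (K * g x) := by
    intro θ k x
    rw [hv]
    simp only [norm_smul, Real.norm_of_nonneg (hε0 k)]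
    exact mul_le_mul_of_nonneg_left
      ((norm_waveRem_le hn hs0 hs1 hφ hc _ θ x).trans (hK x)) (hε0 k)
  have hvn' : ∀ θ k x, ‖v θ k x‖ ≤ K * g x := fun θ k x =>
    (hvn θ k x).trans (mul_le_of_le_one_left (mul_nonneg hK0 (hg0 x)) (hε1 k))
  -- From (a + b)² ≤ 2a² + 2b²; the term K² g² is relaxed to K² g, as 0 ≤ g ≤ 1.
  set b : EuclideanSpace ℝ (Fin n) → ℝ :=
    fun x => n ^ 2 * B * κ ^ 2 * (2 * ‖V‖ ^ 2 * φ x ^ 2 + 2 * K ^ 2 * g x) with hb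
  have hφ2 : Integrable fun x => φ x ^ 2 :=
    integrable_sq_of_hasCompactSupport hφ.continuous hc
  have hbi : Integrable b := ((hφ2.const_mul _).add (hgi.const_mul _)).const_mul _
  have hbound : ∀ θ k, ∀ᵐ x, ‖quadForm (A x) (scaledWaveGrad s φ e θ k x)‖ ≤ b x := by
    intro θ k
    filter_upwards [hB] with x hx
    refine (abs_quadForm_le hx _).trans ?_
    rw [hF, norm_smul, mul_pow, Real.norm_eq_abs, sq_abs]
    have h1 : ‖u θ k x + v θ k x‖ ≤ |φ x| * ‖V‖ + K * g x :=
      (norm_add_le _ _).trans (add_le_add (hun θ k x) (hvn' θ k x))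
    have h2 : ‖u θ k x + v θ k x‖ ^ 2 ≤ 2 * ‖V‖ ^ 2 * φ x ^ 2 + 2 * K ^ 2 * g x := by
      calc _ ≤ (|φ x| * ‖V‖ + K * g x) ^ 2 := by gcongr
        _ ≤ 2 * ((|φ x| * ‖V‖) ^ 2 + (K * g x) ^ 2) := add_sq_le
        _ = 2 * ‖V‖ ^ 2 * φ x ^ 2 + 2 * K ^ 2 * (g x * g x) := by
          rw [mul_pow, sq_abs]; ring
        _ ≤ _ := by
          gcongr
          exact mul_le_of_le_one_left (hg0 x) (hg1 x)
    have h3 : 0 ≤ (n : ℝ) ^ 2 * B * κ ^ 2 := by positivity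
    rw [← mul_assoc]
    exact mul_le_mul_of_nonneg_left h2 h3
  have hmeas : ∀ θ k, AEStronglyMeasurable
      (fun x => quadForm (A x) (scaledWaveGrad s φ e θ k x)) := fun θ k =>
    aestronglyMeasurable_quadForm hA (stronglyMeasurable_scaledWaveGrad hφ.continuous e θ k)
  have hint : ∀ θ k, Integrable (fun x => quadForm (A x) (scaledWaveGrad s φ e θ k x)) :=
    fun θ k => hbi.mono' (hmeas θ k) (hbound θ k)
  simp only [← integral_add (hint 0 _) (hint (Real.pi / 2) _)]
  refine tendsto_integral_of_dominated_convergence (fun x => b x + b x)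
    (fun k => (hmeas 0 k).add (hmeas _ k)) (hbi.add hbi) (fun k => ?_) ?_
  · filter_upwards [hbound 0 k, hbound (Real.pi / 2) k] with x h1 h2
    exact (norm_add_le _ _).trans (add_le_add h1 h2)
  filter_upwards [hB] with x hx
  rw [tendsto_iff_norm_sub_tendsto_zero]
  set d : ℕ → ℝ := fun k => n ^ 2 * B *
    (2 * (|φ x| * ‖V‖) * (ε k * (K * g x)) + (ε k * (K * g x)) ^ 2) with hd
  have hdlim : Tendsto (fun k => κ ^ 2 * (d k + d k)) atTop (𝓝 0) := by
    have h1 : Continuous fun t : ℝ => κ ^ 2 *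
      (n ^ 2 * B * (2 * (|φ x| * ‖V‖) * (t * (K * g x)) + (t * (K * g x)) ^ 2) +
      n ^ 2 * B * (2 * (|φ x| * ‖V‖) * (t * (K * g x)) + (t * (K * g x)) ^ 2)) := by fun_prop
    have := (h1.tendsto 0).comp hεlim
    simpa [hd, Function.comp_def] using this
  refine squeeze_zero (fun _ => norm_nonneg _) (fun k => ?_) hdlim
  have hdiff : ∀ θ, |quadForm (A x) (u θ k x + v θ k x) - quadForm (A x) (u θ k x)| ≤ d k := by
    intro θ
    refine (abs_quadForm_add_sub_le hx _ _).trans ?_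
    simp only [hd]
    have h1 := hun θ k x
    have h2 := hvn θ k x
    gcongr
  -- The quarter-period shift turns sin² into cos², so the leading terms add up to a quantity
  -- independent of k.
  have hsum : quadForm (A x) (u 0 k x) + quadForm (A x) (u (Real.pi / 2) k x)
      = φ x ^ 2 * quadForm (A x) V := by
    simp only [hu, quadForm_smul, add_zero, Real.sin_add_pi_div_two]
    have := Real.sin_sq_add_cos_sq ⟪((k : ℝ) + 1) • e, x⟫
    linear_combination φ x ^ 2 * quadForm (A x) V * this
  rw [hF, hF, quadForm_smul, quadForm_smul, ← mul_add, ← hsum, ← mul_sub, norm_mul,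
    Real.norm_of_nonneg (sq_nonneg κ), add_sub_add_comm]
  gcongr
  exact (norm_add_le _ _).trans (add_le_add (hdiff _) (hdiff _))

theorem integrable_sq_mul_quadForm {A : EuclideanSpace ℝ (Fin n) → Matrix (Fin n) (Fin n) ℝ}
    (hA : ∀ i j, MemLp (fun x => A x i j) ∞ volume) (ξ : EuclideanSpace ℝ (Fin n))
    {f : EuclideanSpace ℝ (Fin n) → ℝ} (hf : Integrable f) :
    Integrable fun x => f x * quadForm (A x) ξ := by
  obtain ⟨B, hB0, hB⟩ := exists_ae_abs_le hA
  refine hf.mul_bdd (c := n ^ 2 * B * ‖ξ‖ ^ 2)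
    (aestronglyMeasurable_quadForm hA stronglyMeasurable_const) ?_
  filter_upwards [hB] with x hx
  exact abs_quadForm_le hx ξ

/-- Both energies have the same high-frequency limit. Since V = c e with c ≠ 0, the factors c² and
κ² cancel. -/
theorem integral_sq_mul_quadForm_eq (hn : 2 ≤ n) (hs0 : 0 < s) (hs1 : s < 1)
    {Ω : Set (EuclideanSpace ℝ (Fin n))}
    {A A' : EuclideanSpace ℝ (Fin n) → Matrix (Fin n) (Fin n) ℝ}
    (hA : ∀ i j, MemLp (fun x => A x i j) ∞ volume)
    (hA' : ∀ i j, MemLp (fun x => A' x i j) ∞ volume)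
    (heq : ∀ ψ : EuclideanSpace ℝ (Fin n) → ℝ, IsTestFunction Ω ψ →
      ∫ x, quadForm (A x) (fracGrad s ψ x) = ∫ x, quadForm (A' x) (fracGrad s ψ x))
    {φ : EuclideanSpace ℝ (Fin n) → ℝ} (hφ : IsTestFunction Ω φ)
    (e : EuclideanSpace ℝ (Fin n)) :
    ∫ x, φ x ^ 2 * quadForm (A x) e = ∫ x, φ x ^ 2 * quadForm (A' x) e := by
  rcases eq_or_ne e 0 with rfl | he
  · simp [quadForm]
  have h1 := tendsto_integral_quadForm_scaledWaveGrad hn hs0 hs1 hφ.1 hφ.2.1 e hA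
  have h2 := tendsto_integral_quadForm_scaledWaveGrad hn hs0 hs1 hφ.1 hφ.2.1 e hA'
  have h3 : ∀ θ k, ∫ x, quadForm (A x) (scaledWaveGrad s φ e θ k x)
      = ∫ x, quadForm (A' x) (scaledWaveGrad s φ e θ k x) := by
    intro θ k
    simp only [scaledWaveGrad, quadForm_smul, integral_const_mul]
    rw [heq _ (isTestFunction_modWave hφ _ θ)]
  simp only [h3] at h1
  have h4 := tendsto_nhds_unique h1 h2
  obtain ⟨c, hc⟩ := exists_waveVec_eq_smul hn hs0 hs1 e
  have hc0 : c ≠ 0 := by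
    rintro rfl
    exact waveVec_ne_zero hn hs0 hs1 he (by rw [hc, zero_smul])
  have h5 : ∀ t q : ℝ, t ^ 2 * (c ^ 2 * q) = c ^ 2 * (t ^ 2 * q) := fun t q => by ring
  simp only [hc, quadForm_smul, h5, integral_const_mul] at h4
  exact mul_left_cancel₀ (pow_ne_zero 2 (fracGrad_const_ne_zero hn hs0 hs1))
    (mul_left_cancel₀ (pow_ne_zero 2 hc0) h4)

/-! ### Localisation and recovery of the entries -/

theorem exists_isTestFunction_eq_one {Ω K : Set (EuclideanSpace ℝ (Fin n))} (hΩ : IsOpen Ω)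
    (hK : IsCompact K) (hKΩ : K ⊆ Ω) :
    ∃ χ, IsTestFunction Ω χ ∧ ∀ x ∈ K, χ x = 1 := by
  obtain ⟨L, hL, hKL, hLΩ⟩ := exists_compact_between hK hΩ hKΩ
  obtain ⟨f, hf1, hf0, -⟩ := exists_contMDiffMap_one_nhds_of_subset_interior
    (n := (⊤ : ℕ∞)) (modelWithCornersSelf ℝ (EuclideanSpace ℝ (Fin n))) hK.isClosed hKL
  have hsupp : tsupport f ⊆ L := closure_minimal
    (fun x hx => by_contra fun hxL => hx (hf0 x hxL)) hL.isClosed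
  exact ⟨f, ⟨f.contMDiff.contDiff, hL.of_isClosed_subset (isClosed_tsupport _) hsupp,
    hsupp.trans hLΩ⟩, fun x hx => hf1.self_of_nhdsSet x hx⟩

theorem IsTestFunction.add {Ω : Set (EuclideanSpace ℝ (Fin n))}
    {φ χ : EuclideanSpace ℝ (Fin n) → ℝ} (hφ : IsTestFunction Ω φ) (hχ : IsTestFunction Ω χ) :
    IsTestFunction Ω (φ + χ) :=
  ⟨hφ.1.add hχ.1, hφ.2.1.add hχ.2.1,
    (tsupport_add φ χ).trans (union_subset hφ.2.2 hχ.2.2)⟩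

/-- So far only squares φ² serve as weights. With a cutoff χ = 1 on the support of φ, 2φ = (φ + χ)²
− φ² − χ², so every test function is an admissible weight and the fundamental lemma applies. -/
theorem ae_quadForm_eq (hn : 2 ≤ n) (hs0 : 0 < s) (hs1 : s < 1)
    {Ω : Set (EuclideanSpace ℝ (Fin n))} (hΩ : IsOpen Ω)
    {A A' : EuclideanSpace ℝ (Fin n) → Matrix (Fin n) (Fin n) ℝ}
    (hA : ∀ i j, MemLp (fun x => A x i j) ∞ volume)
    (hA' : ∀ i j, MemLp (fun x => A' x i j) ∞ volume)
    (heq : ∀ ψ : EuclideanSpace ℝ (Fin n) → ℝ, IsTestFunction Ω ψ →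
      ∫ x, quadForm (A x) (fracGrad s ψ x) = ∫ x, quadForm (A' x) (fracGrad s ψ x))
    (e : EuclideanSpace ℝ (Fin n)) :
    ∀ᵐ x, x ∈ Ω → quadForm (A x) e = quadForm (A' x) e := by
  set q : EuclideanSpace ℝ (Fin n) → ℝ := fun x => quadForm (A x) e - quadForm (A' x) e with hq
  have hqm : AEStronglyMeasurable q :=
    (aestronglyMeasurable_quadForm hA stronglyMeasurable_const).sub
      (aestronglyMeasurable_quadForm hA' stronglyMeasurable_const)
  obtain ⟨B, -, hB⟩ := exists_ae_abs_le hA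
  obtain ⟨B', -, hB'⟩ := exists_ae_abs_le hA'
  have hqb : ∀ᵐ x, ‖q x‖ ≤ n ^ 2 * B * ‖e‖ ^ 2 + n ^ 2 * B' * ‖e‖ ^ 2 := by
    filter_upwards [hB, hB'] with x h1 h2
    exact (norm_sub_le _ _).trans (add_le_add (abs_quadForm_le h1 e) (abs_quadForm_le h2 e))
  have hqi : ∀ f : EuclideanSpace ℝ (Fin n) → ℝ, Integrable f →
      Integrable fun x => f x * q x := fun f hf => hf.mul_bdd hqm hqb
  have hsq : ∀ φ, IsTestFunction Ω φ →
      Integrable (fun x => φ x ^ 2 * q x) ∧ ∫ x, φ x ^ 2 * q x = 0 := by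
    intro φ hφ
    have hφ2 : Integrable fun x => φ x ^ 2 :=
      integrable_sq_of_hasCompactSupport hφ.1.continuous hφ.2.1
    refine ⟨hqi _ hφ2, ?_⟩
    simp only [hq, mul_sub]
    rw [integral_sub (integrable_sq_mul_quadForm hA e hφ2) (integrable_sq_mul_quadForm hA' e hφ2),
      integral_sq_mul_quadForm_eq hn hs0 hs1 hA hA' heq hφ e, sub_self]
  have hloc : LocallyIntegrableOn q Ω := by
    refine LocallyIntegrable.locallyIntegrableOn ?_ Ω
    exact (memLp_top_of_bound hqm _ hqb).locallyIntegrable le_top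
  have hzero := hΩ.ae_eq_zero_of_integral_contDiff_smul_eq_zero hloc fun φ h1 h2 h3 => ?_
  · filter_upwards [hzero] with x hx hxΩ
    exact sub_eq_zero.1 (hx hxΩ)
  have hφ : IsTestFunction Ω φ := ⟨h1, h2, h3⟩
  obtain ⟨χ, hχ, hχ1⟩ := exists_isTestFunction_eq_one hΩ h2.isCompact h3
  have hpol : ∀ x, φ x • q x
      = 2⁻¹ * (((φ + χ) x ^ 2 * q x - φ x ^ 2 * q x) - χ x ^ 2 * q x) := by
    intro x
    have : φ x * χ x = φ x := by
      by_cases hx : x ∈ tsupport φ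
      · rw [hχ1 x hx, mul_one]
      · rw [image_eq_zero_of_notMem_tsupport hx, zero_mul]
    simp only [smul_eq_mul, Pi.add_apply]
    linear_combination -q x * this
  obtain ⟨a1, a2⟩ := hsq _ (hφ.add hχ)
  obtain ⟨b1, b2⟩ := hsq _ hφ
  obtain ⟨c1, c2⟩ := hsq _ hχ
  have hsub := integral_sub (a1.sub b1) c1
  rw [integral_sub' a1 b1, a2, b2, c2, sub_zero, sub_zero] at hsub
  rw [integral_congr_ae (Eventually.of_forall hpol), integral_const_mul]
  exact mul_eq_zero_of_right _ hsub

theorem quadForm_single (M : Matrix (Fin n) (Fin n) ℝ) (i : Fin n) :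
    quadForm M (EuclideanSpace.single i 1) = M i i := by
  simp [quadForm]

theorem quadForm_single_add_single (M : Matrix (Fin n) (Fin n) ℝ) (i j : Fin n) :
    quadForm M (EuclideanSpace.single i 1 + EuclideanSpace.single j 1)
      = M i i + M i j + M j i + M j j := by
  simp [quadForm, Matrix.mulVec_add]; ring

end

theorem mainTheorem6 (n : ℕ) (hn : 2 ≤ n) (s : ℝ) (hs0 : 0 < s) (hs1 : s < 1)
    (Ω : Set (EuclideanSpace ℝ (Fin n))) (hΩ : IsOpen Ω)
    (A A' : EuclideanSpace ℝ (Fin n) → Matrix (Fin n) (Fin n) ℝ)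
    (hA : IsLinftySym A) (hA' : IsLinftySym A')
    (hApos : ∀ᵐ x ∂(volume.restrict Ω), ∀ ξ : EuclideanSpace ℝ (Fin n), 0 ≤ quadForm (A x) ξ)
    (hApos' : ∀ᵐ x ∂(volume.restrict Ω), ∀ ξ : EuclideanSpace ℝ (Fin n), 0 ≤ quadForm (A' x) ξ)
    (heq : ∀ ψ : EuclideanSpace ℝ (Fin n) → ℝ, IsTestFunction Ω ψ →
      ∫ x, quadForm (A x) (fracGrad s ψ x) = ∫ x, quadForm (A' x) (fracGrad s ψ x)) :
    ∀ᵐ x ∂(volume.restrict Ω), A x = A' x := by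
  -- Finitely many directions suffice, so the exceptional null sets, which depend on the direction,
  -- can be merged.
  have h1 : ∀ᵐ x, ∀ i, x ∈ Ω → A x i i = A' x i i := ae_all_iff.2 fun i => by
    simpa only [quadForm_single] using
      ae_quadForm_eq hn hs0 hs1 hΩ hA.1 hA'.1 heq (EuclideanSpace.single i 1)
  have h2 : ∀ᵐ x, ∀ i j, x ∈ Ω →
      A x i i + A x i j + A x j i + A x j j = A' x i i + A' x i j + A' x j i + A' x j j :=
    ae_all_iff.2 fun i => ae_all_iff.2 fun j => by
      filter_upwards [ae_quadForm_eq hn hs0 hs1 hΩ hA.1 hA'.1 heq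
        (EuclideanSpace.single i 1 + EuclideanSpace.single j 1)] with x hx hxΩ
      rw [← quadForm_single_add_single, ← quadForm_single_add_single]
      exact hx hxΩ
  rw [ae_restrict_iff' hΩ.measurableSet]
  filter_upwards [h1, h2, hA.2, hA'.2] with x h1 h2 h3 h4 hx
  ext i j
  have := h2 i j hx
  -- Symmetry merges the two off-diagonal entries into twice one of them.
  rw [h1 i hx, h1 j hx, h3.apply i j, h4.apply i j] at this
  linarith
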